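/- Let $p$ be a prime, $S$ a finite $p$-group and $\mathcal F$ a saturated fusion system on $S$. For a finite group $G$ let $B(G)$ be its Burnside ring (the Grothendieck ring of finite $G$-sets), and for $b\in B(G)$ and $P\le G$ let $|b^P|$ denote the image of $b$ under the ring homomorphism $B(G)\to\mathbb Z$ with $[X]\mapsto|X^P|$. Let $B(\mathcal F)$ be the subring of $B(S)$ consisting of all $b$ with $|b^P|=|b^Q|$ whenever $P,Q\le S$ are isomorphic in $\mathcal F$, and regard $B(\mathcal F)^\times$ as a subgroup of $B(S)^\times$. For $P\le S$, the group $\mathrm{Out}(P)=\mathrm{Aut}(P)/\mathrm{Inn}(P)$ acts on $B(P)$ by ring automorphisms, the class of $\alpha\in\mathrm{Aut}(P)$ sending $[X]$ to the class of the set $X$ on which $g\in P$ acts as $\alpha^{-1}(g)$. Let $\mathrm{Out}_S(P)=\mathrm{Aut}_S(P)/\mathrm{Inn}(P)$ and $\mathrm{Out}_{\mathcal F}(P)=\mathrm{Aut}_{\mathcal F}(P)/\mathrm{Inn}(P)$, where $\mathrm{Aut}_S(P)$ is the group of automorphisms of $P$ induced by conjugation by elements of $S$. Restriction $B(S)\to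 B(P)$ maps $B(S)^\times$ into $(B(P)^\times)^{\mathrm{Out}_S(P)}$, and so induces a group homomorphism $$d^{\mathcal F}_P: B(S)^\times\longrightarrow (B(P)^\times)^{\mathrm{Out}_S(P)}\big/(B(P)^\times)^{\mathrm{Out}_{\mathcal F}(P)} .$$ Then: 1. $B(\mathcal F)^\times=\bigcap_{P\le S}\mathrm{Ker}(d^{\mathcal F}_P)$. 2. $B(\mathcal F)^\times=\bigcap_{R}\mathrm{Ker}(d^{\mathcal F}_R)$, where $R$ runs over the subgroups of $S$ such that $R=S$ or $R$ is $\mathcal F$-essential. Here a subgroup $R<S$ is $\mathcal F$-essential if $C_S(Q)\le Q$ and $|N_S(Q)|\le|N_S(R)|$ for every $Q\le S$ isomorphic to $R$ in $\mathcal F$, and $\mathrm{Out}_{\mathcal F}(R)$ has a strongly $p$-embedded subgroup, that is, a proper subgroup $H$ of order divisible by $p$ such that $H\cap xHx^{-1}$ has order prime to $p$ for every $x\in\mathrm{Out}_{\mathcal F}(R)\setminus H$. -/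

import Mathlib

universe u

/-! ### Finite `G`-sets and the Burnside ring -/

/-- A finite (left) `G`-set. -/
structure FinGSet (G : Type u) [Group G] : Type (u + 1) where
  carrier : Type u
  [finite : Finite carrier]
  [action : MulAction G carrier]

attribute [instance] FinGSet.finite FinGSet.action

namespace FinGSet

variable {G H K : Type u} [Group G] [Group H] [Group K]

/-- Two finite `G`-sets are isomorphic if there is a `G`-equivariant bijection between them. -/
def Isom (X Y : FinGSet G) : Prop :=
  ∃ e : X.carrier ≃ Y.carrier, ∀ (g : G) (x : X.carrier), e (g • x) = g • e x

theorem Isom.refl (X : FinGSet G) : Isom X X := ⟨Equiv.refl _, fun _ _ => rfl⟩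

theorem Isom.symm {X Y : FinGSet G} : Isom X Y → Isom Y X := by
  rintro ⟨e, he⟩
  refine ⟨e.symm, fun g y => ?_⟩
  rw [Equiv.symm_apply_eq, he, Equiv.apply_symm_apply]

theorem Isom.trans {X Y Z : FinGSet G} : Isom X Y → Isom Y Z → Isom X Z := by
  rintro ⟨e, he⟩ ⟨f, hf⟩
  exact ⟨e.trans f, fun g x => by simp [he, hf]⟩

instance setoid (G : Type u) [Group G] : Setoid (FinGSet G) where
  r := Isom
  iseqv := ⟨Isom.refl, Isom.symm, Isom.trans⟩

/-- The direct product `X × Y` with the diagonal action. -/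
def prod (X Y : FinGSet G) : FinGSet G := ⟨X.carrier × Y.carrier⟩

/-- The disjoint union `X ⊔ Y`. -/
def sum (X Y : FinGSet G) : FinGSet G := ⟨X.carrier ⊕ Y.carrier⟩

/-- The one-point `G`-set `G/G`. -/
def point (G : Type u) [Group G] : FinGSet G where
  carrier := PUnit.{u + 1}
  action := { smul := fun _ x => x, one_smul := fun _ => rfl, mul_smul := fun _ _ _ => rfl }

/-- The `H`-set obtained from a `G`-set `X` along a homomorphism `f : H → G`:
the same set, on which `h` acts as `f h`. -/
def pullback (f : H →* G) (X : FinGSet G) : FinGSet H where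
  carrier := X.carrier
  action := MulAction.compHom X.carrier f

/-- The number `|X^P|` of points of `X` fixed by the subgroup `P`. -/
noncomputable def card_fixed (P : Subgroup G) (X : FinGSet G) : ℕ :=
  Nat.card {x : X.carrier // ∀ g ∈ P, g • x = x}

theorem card_fixed_congr (P : Subgroup G) {X Y : FinGSet G} (h : Isom X Y) :
    card_fixed P X = card_fixed P Y := by
  obtain ⟨e, he⟩ := h
  refine Nat.card_congr (e.subtypeEquiv fun x => ?_)
  refine forall₂_congr fun g _ => ?_
  rw [← he, e.apply_eq_iff_eq]

theorem card_fixed_prod (P : Subgroup G) (X Y : FinGSet G) :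
    card_fixed P (X.prod Y) = card_fixed P X * card_fixed P Y := by
  unfold card_fixed
  rw [← Nat.card_prod]
  exact Nat.card_congr
    { toFun := fun x => (⟨x.1.1, fun g hg => congrArg Prod.fst (x.2 g hg)⟩,
        ⟨x.1.2, fun g hg => congrArg Prod.snd (x.2 g hg)⟩)
      invFun := fun x => ⟨(x.1.1, x.2.1), fun g hg => Prod.ext (x.1.2 g hg) (x.2.2 g hg)⟩
      left_inv := fun _ => rfl
      right_inv := fun _ => rfl }

theorem card_fixed_sum (P : Subgroup G) (X Y : FinGSet G) :
    card_fixed P (X.sum Y) = card_fixed P X + card_fixed P Y := by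
  unfold card_fixed
  rw [← Nat.card_sum]
  refine Nat.card_congr
    { toFun := fun x => match x with
        | ⟨Sum.inl x, hx⟩ => Sum.inl ⟨x, fun g hg => Sum.inl_injective (hx g hg)⟩
        | ⟨Sum.inr x, hx⟩ => Sum.inr ⟨x, fun g hg => Sum.inr_injective (hx g hg)⟩
      invFun := fun x => match x with
        | Sum.inl x => ⟨Sum.inl x.1, fun g hg => congrArg Sum.inl (x.2 g hg)⟩
        | Sum.inr x => ⟨Sum.inr x.1, fun g hg => congrArg Sum.inr (x.2 g hg)⟩
      left_inv := ?_
      right_inv := ?_ }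
  · rintro ⟨x | x, hx⟩ <;> rfl
  · rintro (x | x) <;> rfl

theorem card_fixed_point (P : Subgroup G) : card_fixed P (point G) = 1 := by
  unfold card_fixed
  rw [Nat.card_eq_one_iff_unique]
  exact ⟨⟨fun _ _ => Subtype.ext (Subsingleton.elim (α := PUnit) _ _)⟩,
    ⟨⟨PUnit.unit, fun _ _ => rfl⟩⟩⟩

end FinGSet

/-- Isomorphism classes of finite `G`-sets. -/
def GSetClass (G : Type u) [Group G] : Type (u + 1) := Quotient (FinGSet.setoid G)

namespace GSetClass

open FinGSet

variable {G H K : Type u} [Group G] [Group H] [Group K]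

/-- The isomorphism class of a finite `G`-set. -/
def mk (X : FinGSet G) : GSetClass G := Quotient.mk _ X

/-- Isomorphism classes form a commutative monoid under the direct product. -/
instance : CommMonoid (GSetClass G) where
  mul := Quotient.map₂ prod (by
    rintro X X' ⟨e, he⟩ Y Y' ⟨f, hf⟩
    exact ⟨Equiv.prodCongr e f, fun g x => Prod.ext (he g x.1) (hf g x.2)⟩)
  one := mk (point G)
  mul_assoc := by
    rintro ⟨X⟩ ⟨Y⟩ ⟨Z⟩
    exact Quotient.sound ⟨Equiv.prodAssoc _ _ _, fun _ _ => rfl⟩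
  one_mul := by
    rintro ⟨X⟩
    exact Quotient.sound ⟨Equiv.punitProd _, fun _ _ => rfl⟩
  mul_one := by
    rintro ⟨X⟩
    exact Quotient.sound ⟨Equiv.prodPUnit _, fun _ _ => rfl⟩
  mul_comm := by
    rintro ⟨X⟩ ⟨Y⟩
    exact Quotient.sound ⟨Equiv.prodComm _ _, fun _ _ => rfl⟩

/-- Pulling back along `f : H → G` respects isomorphism and products. -/
def pullback (f : H →* G) : GSetClass G →* GSetClass H where
  toFun := Quotient.map (FinGSet.pullback f) (by
    rintro X Y ⟨e, he⟩
    exact ⟨e, fun h x => he (f h) x⟩)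
  map_one' := Quotient.sound ⟨Equiv.refl _, fun _ _ => rfl⟩
  map_mul' := by
    rintro ⟨X⟩ ⟨Y⟩
    exact Quotient.sound ⟨Equiv.refl _, fun _ _ => rfl⟩

/-- `[X] ↦ |X^P|` on isomorphism classes. -/
noncomputable def mark (P : Subgroup G) : GSetClass G →* ℤ where
  toFun := Quotient.lift (fun X => (card_fixed P X : ℤ))
    (fun _ _ h => congrArg _ (card_fixed_congr P h))
  map_one' := by
    change ((card_fixed P (point G) : ℕ) : ℤ) = 1
    rw [card_fixed_point, Nat.cast_one]
  map_mul' := by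
    rintro ⟨X⟩ ⟨Y⟩
    change ((card_fixed P (X.prod Y) : ℕ) : ℤ) = (card_fixed P X : ℤ) * (card_fixed P Y : ℤ)
    rw [card_fixed_prod, Nat.cast_mul]

end GSetClass

/-- The additive relations `[X ⊔ Y] = [X] + [Y]`, as an ideal of the free abelian group on the
isomorphism classes of finite `G`-sets, with the multiplication `[X] [Y] = [X × Y]`. -/
def burnsideRel (G : Type u) [Group G] : Ideal (FreeAbelianGroup (GSetClass G)) :=
  Ideal.span {a | ∃ X Y : FinGSet G, a = FreeAbelianGroup.of (GSetClass.mk (X.sum Y)) -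
    (FreeAbelianGroup.of (GSetClass.mk X) + FreeAbelianGroup.of (GSetClass.mk Y))}

/-- The Burnside ring `B(G)`: the Grothendieck ring of the category of finite `G`-sets, that is, the
free abelian group on the isomorphism classes `[X]` modulo `[X ⊔ Y] = [X] + [Y]`,
with `[X] [Y] = [X × Y]`. -/
def BurnsideRing (G : Type u) [Group G] : Type (u + 1) :=
  FreeAbelianGroup (GSetClass G) ⧸ burnsideRel G

namespace BurnsideRing

variable {G H K : Type u} [Group G] [Group H] [Group K]

noncomputable instance : CommRing (BurnsideRing G) :=
  inferInstanceAs (CommRing (FreeAbelianGroup (GSetClass G) ⧸ burnsideRel G))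

/-- The quotient map onto `B(G)`. -/
noncomputable def toBurnside (G : Type u) [Group G] : FreeAbelianGroup (GSetClass G) →+* BurnsideRing G :=
  Ideal.Quotient.mk (burnsideRel G)

/-- The class `[X]` of a finite `G`-set in `B(G)`. -/
noncomputable def ofGSet (X : FinGSet G) : BurnsideRing G :=
  toBurnside G (FreeAbelianGroup.of (GSetClass.mk X))

theorem hom_ext {R : Type*} [CommRing R] {f g : BurnsideRing G →+* R}
    (h : ∀ X, f (ofGSet X) = g (ofGSet X)) : f = g := by
  have h1 : ∀ a, f (toBurnside G a) = g (toBurnside G a) := fun a => by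
    induction a using FreeAbelianGroup.induction_on with
    | zero => simp
    | of x =>
      obtain ⟨X⟩ := x
      exact h X
    | neg x hx => simp only [map_neg, hx]
    | add x y hx hy => simp only [map_add, hx, hy]
  ext b
  obtain ⟨a, rfl⟩ := Ideal.Quotient.mk_surjective b
  exact h1 a

/-- A multiplicative and additive function on isomorphism classes extends to a ring
homomorphism on `B(G)`. -/
noncomputable def lift {R : Type*} [CommRing R] (f : GSetClass G →* R)
    (hf : ∀ X Y : FinGSet G, f (.mk (X.sum Y)) = f (.mk X) + f (.mk Y)) : BurnsideRing G →+* R :=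
  Ideal.Quotient.lift (burnsideRel G) (FreeAbelianGroup.liftMonoid f) (by
    intro a ha
    have : burnsideRel G ≤ RingHom.ker (FreeAbelianGroup.liftMonoid f) := by
      refine Ideal.span_le.mpr ?_
      rintro _ ⟨X, Y, rfl⟩
      simp [RingHom.mem_ker, hf]
    exact this ha)

theorem lift_ofGSet {R : Type*} [CommRing R] (f : GSetClass G →* R)
    (hf : ∀ X Y : FinGSet G, f (.mk (X.sum Y)) = f (.mk X) + f (.mk Y)) (X : FinGSet G) :
    lift f hf (ofGSet X) = f (.mk X) := by
  change FreeAbelianGroup.liftMonoid f (FreeAbelianGroup.of _) = _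
  simp

theorem ofGSet_sum (X Y : FinGSet G) : ofGSet (X.sum Y) = ofGSet X + ofGSet Y := by
  have : FreeAbelianGroup.of (GSetClass.mk (X.sum Y)) -
      (FreeAbelianGroup.of (GSetClass.mk X) + FreeAbelianGroup.of (GSetClass.mk Y)) ∈
      burnsideRel G := Ideal.subset_span ⟨X, Y, rfl⟩
  exact ((Ideal.Quotient.eq (I := burnsideRel G)).mpr this).trans (map_add _ _ _)

theorem ofGSet_eq_of_isom {X Y : FinGSet G} (h : X.Isom Y) : ofGSet X = ofGSet Y := by
  have : GSetClass.mk X = GSetClass.mk Y := Quotient.sound h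
  unfold ofGSet
  rw [this]

/-- The classes `[X]`, as a multiplicative map. -/
noncomputable def classHom (G : Type u) [Group G] : GSetClass G →* BurnsideRing G :=
  ((toBurnside G).toMonoidHom).comp FreeAbelianGroup.ofMulHom

/-- The mark homomorphism `b ↦ |b^P|`, the `P`-component of the ghost map. It extends
`[X] ↦ |X^P|`. -/
noncomputable def mark (P : Subgroup G) : BurnsideRing G →+* ℤ :=
  lift (GSetClass.mark P) (fun X Y => by
    change ((FinGSet.card_fixed P (X.sum Y) : ℕ) : ℤ) =
      (FinGSet.card_fixed P X : ℤ) + (FinGSet.card_fixed P Y : ℤ)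
    rw [FinGSet.card_fixed_sum, Nat.cast_add])

theorem mark_ofGSet (P : Subgroup G) (X : FinGSet G) :
    mark P (ofGSet X) = (FinGSet.card_fixed P X : ℤ) := lift_ofGSet _ _ X

/-- The ring homomorphism `B(G) → B(H)` induced by `f : H → G`, sending `[X]` to the class of `X`
with `H` acting through `f`. -/
noncomputable def pullback (f : H →* G) : BurnsideRing G →+* BurnsideRing H :=
  lift ((classHom H).comp (GSetClass.pullback f)) (fun X Y =>
    (ofGSet_eq_of_isom (X := (X.sum Y).pullback f)
      (Y := (X.pullback f).sum (Y.pullback f)) ⟨Equiv.refl _, by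
        rintro h (x | x) <;> rfl⟩).trans (ofGSet_sum _ _))

theorem pullback_ofGSet (f : H →* G) (X : FinGSet G) :
    pullback f (ofGSet X) = ofGSet (X.pullback f) := lift_ofGSet _ _ X

theorem pullback_comp (f : H →* G) (g : K →* H) :
    (pullback g).comp (pullback f) = pullback (f.comp g) := by
  refine hom_ext fun X => ?_
  simp only [RingHom.comp_apply, pullback_ofGSet]
  exact ofGSet_eq_of_isom ⟨Equiv.refl _, fun _ _ => rfl⟩

theorem pullback_id : pullback (MonoidHom.id G) = RingHom.id (BurnsideRing G) := by
  refine hom_ext fun X => ?_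
  simp only [RingHom.id_apply, pullback_ofGSet]
  exact ofGSet_eq_of_isom ⟨Equiv.refl _, fun _ _ => rfl⟩

/-- Inner automorphisms act trivially: `x ↦ g⁻¹ • x` is an isomorphism. -/
theorem pullback_conj (g : G) :
    pullback (MulAut.conj g).toMonoidHom = RingHom.id (BurnsideRing G) := by
  refine hom_ext fun X => ?_
  simp only [RingHom.id_apply, pullback_ofGSet]
  refine ofGSet_eq_of_isom ⟨MulAction.toPerm (α := G) (β := X.carrier) g⁻¹, fun h x => ?_⟩
  have key : ∀ x : X.carrier, g⁻¹ • ((g * h * g⁻¹) • x) = h • g⁻¹ • x := fun x => by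
    rw [smul_smul, smul_smul]
    simp [mul_assoc]
  exact key x

/-- The restriction map `B(Res^G_P) : B(G) → B(P)`. -/
noncomputable def res (P : Subgroup G) : BurnsideRing G →+* BurnsideRing P := pullback P.subtype

end BurnsideRing

/-! ### Outer automorphisms and their action on the Burnside ring -/

section Out

variable {G : Type u} [Group G]

/-- The group `Inn(G)` of inner automorphisms `c_g : x ↦ g x g⁻¹`. -/
def innerAut (G : Type u) [Group G] : Subgroup (MulAut G) := (MulAut.conj : G →* MulAut G).range

instance : (innerAut G).Normal := ⟨by
  rintro _ ⟨g, rfl⟩ α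
  refine ⟨α g, ?_⟩
  ext x
  simp [MulAut.mul_apply]⟩

/-- `Out(G) = Aut(G) / Inn(G)`. -/
abbrev OuterAut (G : Type u) [Group G] : Type u := MulAut G ⧸ innerAut G

/-- The action of `Aut(G)` on `B(G)` by ring automorphisms: `α · [X]` is the class of the transport
of `X` along `α`, the set `X` on which `g` acts as `α⁻¹(g)`; this is `Iso(α) ×_G X`,
through `(u, x) ↦ α⁻¹(u) x`. -/
noncomputable def autAction (G : Type u) [Group G] : MulAut G →* RingAut (BurnsideRing G) where
  toFun α := RingEquiv.ofRingHom (BurnsideRing.pullback (α⁻¹ : MulAut G).toMonoidHom)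
    (BurnsideRing.pullback α.toMonoidHom)
    (by
      rw [BurnsideRing.pullback_comp, ← BurnsideRing.pullback_id]
      congr 1
      ext x
      exact α.apply_symm_apply x)
    (by
      rw [BurnsideRing.pullback_comp, ← BurnsideRing.pullback_id]
      congr 1
      ext x
      exact α.symm_apply_apply x)
  map_one' := by
    ext b
    exact DFunLike.congr_fun (BurnsideRing.pullback_id (G := G)) b
  map_mul' α β := by
    ext b
    exact DFunLike.congr_fun
      (BurnsideRing.pullback_comp (β⁻¹ : MulAut G).toMonoidHom (α⁻¹ : MulAut G).toMonoidHom).symm b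

theorem autAction_apply (α : MulAut G) (b : BurnsideRing G) :
    autAction G α b = BurnsideRing.pullback (α⁻¹ : MulAut G).toMonoidHom b := rfl

/-- `Inn(G)` acts trivially, so `Out(G)` acts on `B(G)` by ring automorphisms. -/
noncomputable def outAction (G : Type u) [Group G] : OuterAut G →* RingAut (BurnsideRing G) :=
  QuotientGroup.lift (innerAut G) (autAction G) (by
    rintro _ ⟨g, rfl⟩
    ext b
    rw [autAction_apply, ← map_inv, BurnsideRing.pullback_conj]
    rfl)

theorem outAction_mk (α : MulAut G) : outAction G (α : OuterAut G) = autAction G α := rfl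

/-- The fixed points `(B(G)^×)^Γ` for a subgroup `Γ ≤ Out(G)`. -/
def fixedUnits (Γ : Subgroup (OuterAut G)) : Subgroup (BurnsideRing G)ˣ where
  carrier := {u | ∀ γ ∈ Γ, outAction G γ (u : BurnsideRing G) = u}
  one_mem' γ _ := map_one _
  mul_mem' {u v} hu hv γ hγ := by rw [Units.val_mul, map_mul, hu γ hγ, hv γ hγ]
  inv_mem' {u} hu γ hγ := by
    have h : Units.map (outAction G γ : BurnsideRing G →* BurnsideRing G) u = u :=
      Units.ext (hu γ hγ)
    have h' := congrArg (fun v => ((v⁻¹ : (BurnsideRing G)ˣ) : BurnsideRing G)) h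
    simpa using h'

end Out

/-! ### Fusion systems -/

section Conj

variable {S : Type u} [Group S]

/-- `Hom_S(P, Q)`: homomorphisms `P → Q` given by conjugation by an element of `S`. -/
def conjHom (P Q : Subgroup S) : Set (P →* Q) :=
  {φ | ∃ g : S, ∀ x : P, (φ x : S) = g * x * g⁻¹}

/-- `Aut_S(P)`: automorphisms of `P` given by conjugation by an element of `S`. -/
def autS (P : Subgroup S) : Subgroup (MulAut P) := P.normalizerMonoidHom.range

/-- `Out_S(P) = Aut_S(P) / Inn(P)`, as a subgroup of `Out(P)`. -/
def outS (P : Subgroup S) : Subgroup (OuterAut P) := (autS P).map (QuotientGroup.mk' (innerAut P))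

/-- For an isomorphism `φ : Q → P`, the subgroup
`N_φ = {g ∈ N_S(Q) | φ c_g φ⁻¹ ∈ Aut_S(P)}` of `S`. -/
def extensionDomain {P Q : Subgroup S} (φ : Q ≃* P) : Subgroup S :=
  (((autS P).comap (MulAut.congr φ).toMonoidHom).comap Q.normalizerMonoidHom).map
    (Subgroup.normalizer (Q : Set S)).subtype

theorem le_extensionDomain {P Q : Subgroup S} (φ : Q ≃* P) : Q ≤ extensionDomain φ := by
  intro x hx
  refine ⟨⟨x, Subgroup.le_normalizer hx⟩, ?_, rfl⟩
  refine ⟨⟨φ ⟨x, hx⟩, Subgroup.le_normalizer (φ ⟨x, hx⟩).2⟩, ?_⟩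
  ext y
  obtain ⟨z, rfl⟩ := φ.surjective y
  have key : (MulAut.congr φ) (Q.normalizerMonoidHom ⟨x, Subgroup.le_normalizer hx⟩) (φ z) =
      φ (⟨x, hx⟩ * z * ⟨x, hx⟩⁻¹) :=
    congrArg (fun w => φ (Q.normalizerMonoidHom ⟨x, Subgroup.le_normalizer hx⟩ w))
      (φ.symm_apply_apply z)
  refine Eq.trans ?_ (congrArg Subtype.val key).symm
  rw [map_mul, map_mul, map_inv]
  rfl

end Conj

/-- A fusion system on `S`: a category whose objects are the subgroups of `S` and whose morphisms
are injective group homomorphisms (with their usual composition), which contains all conjugations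
by elements of `S`, and in which every morphism is an isomorphism of the category followed by an
inclusion. The identities and inclusions are conjugations by `1`. -/
structure FusionSystem (S : Type u) [Group S] where
  /-- `Hom_F(P, Q)` -/
  hom (P Q : Subgroup S) : Set (P →* Q)
  injective {P Q : Subgroup S} {φ : P →* Q} : φ ∈ hom P Q → Function.Injective φ
  comp_mem {P Q R : Subgroup S} {φ : P →* Q} {ψ : Q →* R} :
    φ ∈ hom P Q → ψ ∈ hom Q R → ψ.comp φ ∈ hom P R
  conj_mem (P Q : Subgroup S) : conjHom P Q ⊆ hom P Q
  factor {P Q : Subgroup S} {φ : P →* Q} : φ ∈ hom P Q →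
    ∃ (R : Subgroup S) (h : R ≤ Q) (e : P ≃* R),
      e.toMonoidHom ∈ hom P R ∧ e.symm.toMonoidHom ∈ hom R P ∧
        φ = (Subgroup.inclusion h).comp e.toMonoidHom

namespace FusionSystem

variable {S : Type u} [Group S] (F : FusionSystem S)

/-- `Iso_F(P, Q)`: the isomorphisms from `P` to `Q` in the category `F`. -/
def iso (P Q : Subgroup S) : Set (P ≃* Q) :=
  {e | e.toMonoidHom ∈ F.hom P Q ∧ e.symm.toMonoidHom ∈ F.hom Q P}

/-- `P` and `Q` are `F`-conjugate if they are isomorphic in `F`. -/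
def IsConj (P Q : Subgroup S) : Prop := (F.iso P Q).Nonempty

/-- `Aut_F(P) = Hom_F(P, P)`, as a subgroup of `Aut(P)`. -/
def aut (P : Subgroup S) : Subgroup (MulAut P) where
  carrier := {α | MulEquiv.toMonoidHom α ∈ F.hom P P}
  one_mem' := F.conj_mem P P ⟨1, fun x => by simp⟩
  mul_mem' {α β} hα hβ := F.comp_mem (φ := MulEquiv.toMonoidHom β) (ψ := MulEquiv.toMonoidHom α)
    hβ hα
  inv_mem' {α} hα := by
    obtain ⟨R, h, e, -, he', heq⟩ := F.factor hα
    have hval : ∀ x : P, ((e x : R) : S) = (α x : S) := fun x =>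
      (congrArg (Subtype.val) (DFunLike.congr_fun heq x)).symm
    have hR : P ≤ R := fun x hx => by
      obtain ⟨y, hy⟩ := α.surjective ⟨x, hx⟩
      have h1 := hval y
      rw [hy] at h1
      have h2 : ((e y : R) : S) = x := h1
      rw [← h2]
      exact (e y).2
    obtain rfl : R = P := le_antisymm h hR
    have : e = α := by
      ext x
      exact hval x
    rw [this] at he'
    exact he'

/-- `Out_F(P) = Aut_F(P) / Inn(P)`, as a subgroup of `Out(P)`. -/
def out (P : Subgroup S) : Subgroup (OuterAut P) :=
  (F.aut P).map (QuotientGroup.mk' (innerAut P))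

theorem autS_le_aut (P : Subgroup S) : autS P ≤ F.aut P := by
  rintro _ ⟨g, rfl⟩
  exact F.conj_mem P P ⟨g, fun _ => rfl⟩

theorem outS_le_out (P : Subgroup S) : outS P ≤ F.out P := Subgroup.map_mono (F.autS_le_aut P)

theorem fixedUnits_out_le (P : Subgroup S) : fixedUnits (F.out P) ≤ fixedUnits (outS P) :=
  fun _ hu γ hγ => hu γ (F.outS_le_out P hγ)

/-- `P` is fully `F`-automized: `Aut_S(P)` is a Sylow `p`-subgroup of `Aut_F(P)`. -/
def FullyAutomized (p : ℕ) (P : Subgroup S) : Prop :=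
  ∃ T : Sylow p (F.aut P), (T : Subgroup (F.aut P)) = (autS P).subgroupOf (F.aut P)

/-- `P` is receptive: each isomorphism `φ : Q → P` in `F` extends to a morphism `N_φ → S` in `F`. -/
def Receptive (P : Subgroup S) : Prop :=
  ∀ (Q : Subgroup S) (φ : Q ≃* P), φ ∈ F.iso Q P →
    ∃ ψ ∈ F.hom (extensionDomain φ) ⊤,
      ∀ x : Q, (ψ (Subgroup.inclusion (le_extensionDomain φ) x) : S) = φ x

/-- `F` is saturated: each subgroup of `S` is `F`-conjugate to one that is fully automized and
receptive. -/
def IsSaturated (p : ℕ) : Prop :=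
  ∀ P : Subgroup S, ∃ Q : Subgroup S, F.IsConj P Q ∧ F.FullyAutomized p Q ∧ F.Receptive Q

/-- `P` is `F`-centric: `C_S(Q) ≤ Q` for each `F`-conjugate `Q` of `P`. -/
def IsCentric (P : Subgroup S) : Prop :=
  ∀ Q : Subgroup S, F.IsConj P Q → Subgroup.centralizer (Q : Set S) ≤ Q

/-- `P` is fully normalized: `|N_S(Q)| ≤ |N_S(P)|` for each `F`-conjugate `Q` of `P`. -/
def FullyNormalized (P : Subgroup S) : Prop :=
  ∀ Q : Subgroup S, F.IsConj P Q →
    Nat.card (Subgroup.normalizer (Q : Set S)) ≤ Nat.card (Subgroup.normalizer (P : Set S))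

end FusionSystem

/-- A proper subgroup `H < G` is strongly `p`-embedded if `p` divides `|H|` and `H ∩ x H x⁻¹` has
order prime to `p` for each `x ∈ G \ H`. -/
def IsStronglyEmbedded (p : ℕ) {G : Type u} [Group G] (H : Subgroup G) : Prop :=
  H ≠ ⊤ ∧ p ∣ Nat.card H ∧
    ∀ x : G, x ∉ H → (Nat.card (H ⊓ H.map (MulAut.conj x).toMonoidHom : Subgroup G)).Coprime p

namespace FusionSystem

variable {S : Type u} [Group S] (F : FusionSystem S)

/-- A proper subgroup `P < S` is `F`-essential if it is `F`-centric and fully normalized, and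
`Out_F(P)` has a strongly `p`-embedded subgroup. -/
def IsEssential (p : ℕ) (P : Subgroup S) : Prop :=
  P ≠ ⊤ ∧ F.IsCentric P ∧ F.FullyNormalized P ∧
    ∃ H : Subgroup (F.out P), IsStronglyEmbedded p H

/-- The Burnside ring `B(F)`: the subring of those `b ∈ B(S)` with `|b^P| = |b^Q|` whenever `P` and
`Q` are isomorphic in `F`. -/
noncomputable def burnsideRing : Subring (BurnsideRing S) where
  carrier := {b | ∀ P Q : Subgroup S, F.IsConj P Q →
    BurnsideRing.mark P b = BurnsideRing.mark Q b}
  zero_mem' P Q _ := by rw [map_zero, map_zero]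
  one_mem' P Q _ := by rw [map_one, map_one]
  add_mem' ha hb P Q h := by rw [map_add, map_add, ha P Q h, hb P Q h]
  mul_mem' ha hb P Q h := by rw [map_mul, map_mul, ha P Q h, hb P Q h]
  neg_mem' ha P Q h := by rw [map_neg, map_neg, ha P Q h]

/-- The unit group `B(F)^×`, as a subgroup of `B(S)^×`. -/
noncomputable def burnsideUnits : Subgroup (BurnsideRing S)ˣ :=
  (Units.map (F.burnsideRing.subtype : F.burnsideRing →* BurnsideRing S)).range

end FusionSystem

section Restriction

variable {S : Type u} [Group S]

/-- The restriction of an element of `B(S)` to `B(P)` is fixed by `Out_S(P)`. -/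
theorem res_fixed (P : Subgroup S) (b : BurnsideRing S) :
    ∀ γ ∈ outS P, outAction P γ (BurnsideRing.res P b) = BurnsideRing.res P b := by
  rintro _ ⟨_, ⟨g, rfl⟩, rfl⟩
  change (BurnsideRing.pullback _) (BurnsideRing.pullback _ b) = BurnsideRing.pullback _ b
  rw [← RingHom.comp_apply, BurnsideRing.pullback_comp, ← map_inv]
  have h : P.subtype.comp (P.normalizerMonoidHom g⁻¹).toMonoidHom =
      (MulAut.conj ((g⁻¹ : Subgroup.normalizer (P : Set S)) : S)).toMonoidHom.comp P.subtype := by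
    ext x
    rfl
  rw [h, ← BurnsideRing.pullback_comp, BurnsideRing.pullback_conj]
  rfl

/-- Restriction as a homomorphism `B(S)^× → (B(P)^×)^{Out_S(P)}`. -/
noncomputable def resUnits (P : Subgroup S) : (BurnsideRing S)ˣ →* fixedUnits (outS P) :=
  (Units.map (BurnsideRing.res P : BurnsideRing S →* BurnsideRing P)).codRestrict
    (fixedUnits (outS P)) (fun u => res_fixed P u)

end Restriction

/-- The map `d^F_P : B(S)^× → (B(P)^×)^{Out_S(P)} / (B(P)^×)^{Out_F(P)}` induced by restriction. -/
noncomputable def FusionSystem.d {S : Type u} [Group S] (F : FusionSystem S) (P : Subgroup S) :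
    (BurnsideRing S)ˣ →*
      fixedUnits (outS P) ⧸ (fixedUnits (F.out P)).subgroupOf (fixedUnits (outS P)) :=
  (QuotientGroup.mk' _).comp (resUnits P)

/-! ### The mark homomorphisms are jointly injective -/

namespace FinGSet

variable {G H : Type u} [Group G] [Group H]

/-! Write f(A) = |u^A| for a unit u of B(S). Marks separate the elements of B(P), and twisting by an
automorphism permutes the marks, so u lies in Ker(d_P) exactly when every α in Aut_F(P) satisfies
f(α(A)) = f(A) for all A ≤ P (`mem_ker_d_iff`). Marks of units are ±1, so u⁻¹ has the same marks as
u, and u lies in B(F)^× exactly when f is constant on F-conjugacy classes (`mem_burnsideUnits_iff`).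
Hence B(F)^× lies in every kernel.

The converse is Alperin's fusion theorem, phrased for an arbitrary function f on subgroups so that
no morphism has to be decomposed explicitly (`preserves_of_isSaturated`). Induct downwards on |P|
and choose a fully automized, receptive conjugate Q of P. If Q < S, suitable isomorphisms from
conjugates of Q to Q extend to normalizers, which are larger, so by induction they preserve f; only
Aut_F(Q) remains. If some automorphism of Q fails to preserve f, those that do have a proper image
in Out_F(Q). This image is strongly p-embedded: an automorphism conjugating a nontrivial element of
Out_S(Q) into Out_S(Q) extends beyond Q, hence preserves f. So Q is essential
(`isEssential_of_not_preserves`), and the hypothesis applies to it. -/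

theorem Isom.sum {X X' Y Y' : FinGSet G} : Isom X X' → Isom Y Y' → Isom (X.sum Y) (X'.sum Y') := by
  rintro ⟨e, he⟩ ⟨f, hf⟩
  refine ⟨Equiv.sumCongr e f, ?_⟩
  rintro g (x | y)
  · exact congrArg Sum.inl (he g x)
  · exact congrArg Sum.inr (hf g y)

/-- The empty `G`-set. -/
def empty (G : Type u) [Group G] : FinGSet G where
  carrier := PEmpty.{u + 1}
  action := { smul := fun _ x => x, one_smul := fun _ => rfl, mul_smul := fun _ _ _ => rfl }

/-- The orbit of a point, as a `G`-set. -/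
def orbit (X : FinGSet G) (x : X.carrier) : FinGSet G := ⟨MulAction.orbit G x⟩

/-- The complement of the orbit of a point, as a `G`-set. -/
def compl_orbit (X : FinGSet G) (x : X.carrier) : FinGSet G where
  carrier := {y : X.carrier // y ∉ MulAction.orbit G x}
  action :=
    { smul := fun g y => ⟨g • y.1, fun ⟨a, ha⟩ => y.2 ⟨g⁻¹ * a, by
        have ha : a • x = g • y.1 := ha
        change (g⁻¹ * a) • x = y.1
        rw [mul_smul, ha, inv_smul_smul]⟩⟩
      one_smul := fun y => Subtype.ext (one_smul G y.1)
      mul_smul := fun g h y => Subtype.ext (mul_smul g h y.1) }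

theorem isom_orbit_sum_compl_orbit (X : FinGSet G) (x : X.carrier) :
    Isom ((X.orbit x).sum (X.compl_orbit x)) X := by
  classical
  refine ⟨Equiv.sumCompl (fun y => y ∈ MulAction.orbit G x), ?_⟩
  rintro g (y | y) <;> rfl

theorem isom_orbit_of_stabilizer_eq {X Y : FinGSet G} {x : X.carrier} {y : Y.carrier}
    (h : MulAction.stabilizer G x = MulAction.stabilizer G y) :
    Isom (X.orbit x) (Y.orbit y) := by
  refine ⟨(MulAction.orbitEquivQuotientStabilizer G x).trans
    ((Subgroup.quotientEquivOfEq h).trans (MulAction.orbitEquivQuotientStabilizer G y).symm), ?_⟩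
  rintro g ⟨_, k, rfl⟩
  have hx : ∀ a : G, (MulAction.orbitEquivQuotientStabilizer G x) ⟨a • x, a, rfl⟩ = (a : G ⧸ _) :=
    fun a => by
      rw [← Equiv.eq_symm_apply]
      exact Subtype.ext (MulAction.orbitEquivQuotientStabilizer_symm_apply G x a).symm
  have key : ∀ a : G, ((MulAction.orbitEquivQuotientStabilizer G x).trans
      ((Subgroup.quotientEquivOfEq h).trans (MulAction.orbitEquivQuotientStabilizer G y).symm))
        ⟨a • x, a, rfl⟩ = ⟨a • y, a, rfl⟩ := fun a => by
    rw [Equiv.trans_apply, hx]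
    exact Subtype.ext (MulAction.orbitEquivQuotientStabilizer_symm_apply G y a)
  have h1 : (g • (⟨k • x, k, rfl⟩ : MulAction.orbit G x)) = ⟨(g * k) • x, g * k, rfl⟩ :=
    Subtype.ext (mul_smul g k x).symm
  refine (congrArg _ h1).trans ((key (g * k)).trans ?_)
  refine Eq.trans ?_ (congrArg (fun z => g • z) (key k)).symm
  exact Subtype.ext (mul_smul g k y)

theorem card_fixed_pos_iff (P : Subgroup G) (X : FinGSet G) :
    0 < card_fixed P X ↔ ∃ x : X.carrier, P ≤ MulAction.stabilizer G x := by
  unfold card_fixed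
  rw [Nat.card_pos_iff, nonempty_subtype, and_iff_left (by infer_instance)]
  rfl

theorem card_fixed_pullback (f : H →* G) (P : Subgroup H) (X : FinGSet G) :
    card_fixed P (X.pullback f) = card_fixed (P.map f) X := by
  refine Nat.card_congr (Equiv.subtypeEquivRight fun x => ?_)
  constructor
  · rintro h _ ⟨g, hg, rfl⟩
    exact h g hg
  · exact fun h g hg => h (f g) ⟨g, hg, rfl⟩

/-- Burnside: a finite `G`-set is determined by its numbers of fixed points. -/
theorem isom_of_card_fixed_eq [Finite G] {X Y : FinGSet G}
    (h : ∀ P : Subgroup G, card_fixed P X = card_fixed P Y) : Isom X Y := by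
  induction hn : Nat.card X.carrier using Nat.strong_induction_on generalizing X Y with
  | _ n ih =>
  subst hn
  rcases isEmpty_or_nonempty X.carrier with hX | ⟨⟨x₀⟩⟩
  · have hY : IsEmpty Y.carrier := ⟨fun y => by
      have h1 := (card_fixed_pos_iff ⊥ Y).mpr ⟨y, bot_le⟩
      rw [← h, card_fixed_pos_iff] at h1
      exact hX.elim h1.choose⟩
    exact ⟨Equiv.equivOfIsEmpty _ _, fun _ x => hX.elim x⟩
  -- Take x with maximal stabilizer. Equal fixed-point counts give y in Y with a stabilizer at least
  -- as large, and then z in X with one at least as large as that of y; maximality makes all three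
  -- equal. The orbits of x and y can then be removed from both sides.
  · obtain ⟨_, ⟨x, rfl⟩, hmax⟩ := (Set.toFinite
      (Set.range fun x : X.carrier => MulAction.stabilizer G x)).exists_maximal ⟨_, x₀, rfl⟩
    obtain ⟨y, hy⟩ := (card_fixed_pos_iff (MulAction.stabilizer G x) Y).mp (by
      rw [← h, card_fixed_pos_iff]
      exact ⟨x, le_rfl⟩)
    obtain ⟨z, hz⟩ := (card_fixed_pos_iff (MulAction.stabilizer G y) X).mp (by
      rw [h, card_fixed_pos_iff]
      exact ⟨y, le_rfl⟩)
    have hxy : MulAction.stabilizer G x = MulAction.stabilizer G y :=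
      le_antisymm hy (hz.trans (hmax ⟨z, rfl⟩ (hy.trans hz)))
    have ho := isom_orbit_of_stabilizer_eq hxy
    have hX := isom_orbit_sum_compl_orbit X x
    have hY := isom_orbit_sum_compl_orbit Y y
    refine (hX.symm.trans (ho.sum (ih _ ?_ (fun P => ?_) rfl))).trans hY
    · have h1 : Nat.card X.carrier = Nat.card (X.orbit x).carrier +
          Nat.card (X.compl_orbit x).carrier := by
        rw [← Nat.card_sum]
        exact (Nat.card_congr hX.choose).symm
      have h2 : 0 < Nat.card (X.orbit x).carrier :=
        Nat.card_pos_iff.mpr ⟨⟨⟨x, MulAction.mem_orbit_self x⟩⟩, inferInstance⟩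
      omega
    · have h1 := h P
      rw [← card_fixed_congr P hX, ← card_fixed_congr P hY, card_fixed_sum, card_fixed_sum,
        card_fixed_congr P ho] at h1
      omega

end FinGSet

/-! ### The ghost map of the Burnside ring -/

namespace BurnsideRing

variable {G H : Type u} [Group G] [Group H]

theorem ofGSet_empty : ofGSet (FinGSet.empty G) = 0 := by
  have h : ((FinGSet.empty G).sum (FinGSet.empty G)).Isom (FinGSet.empty G) :=
    ⟨Equiv.equivOfIsEmpty (PEmpty ⊕ PEmpty) PEmpty, fun _ x => by rcases x with x | x <;> cases x⟩
  have := ofGSet_eq_of_isom h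
  rw [ofGSet_sum] at this
  exact left_eq_add.mp this.symm

theorem exists_eq_ofGSet_sub (b : BurnsideRing G) :
    ∃ X Y : FinGSet G, b = ofGSet X - ofGSet Y := by
  obtain ⟨a, rfl⟩ : ∃ a, toBurnside G a = b := Ideal.Quotient.mk_surjective b
  induction a using FreeAbelianGroup.induction_on with
  | zero => exact ⟨.empty G, .empty G, by rw [map_zero, sub_self]⟩
  | of x =>
    obtain ⟨X⟩ := x
    exact ⟨X, .empty G, by rw [ofGSet_empty, sub_zero]; rfl⟩
  | neg x hx =>
    obtain ⟨X, Y, h⟩ := hx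
    exact ⟨Y, X, by rw [map_neg, h, neg_sub]⟩
  | add x y hx hy =>
    obtain ⟨X, Y, h⟩ := hx
    obtain ⟨X', Y', h'⟩ := hy
    exact ⟨X.sum X', Y.sum Y', by rw [map_add, h, h', ofGSet_sum, ofGSet_sum]; ring⟩

/-- The ghost map of the Burnside ring of a finite group is injective. -/
theorem ext_mark [Finite G] {b c : BurnsideRing G} (h : ∀ P, mark P b = mark P c) : b = c := by
  obtain ⟨X, Y, hXY⟩ := exists_eq_ofGSet_sub (b - c)
  have hiso : X.Isom Y := FinGSet.isom_of_card_fixed_eq fun P => by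
    have h1 := congrArg (mark P) hXY
    rw [map_sub, map_sub, h P, sub_self, mark_ofGSet, mark_ofGSet] at h1
    omega
  rw [ofGSet_eq_of_isom hiso, sub_self] at hXY
  exact sub_eq_zero.mp hXY

theorem mark_pullback (f : H →* G) (P : Subgroup H) (b : BurnsideRing G) :
    mark P (pullback f b) = mark (P.map f) b := by
  have : (mark P).comp (pullback f) = mark (P.map f) := hom_ext fun X => by
    rw [RingHom.comp_apply, pullback_ofGSet, mark_ofGSet, mark_ofGSet,
      FinGSet.card_fixed_pullback]
  exact DFunLike.congr_fun this b

end BurnsideRing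

/-! ### Strongly embedded subgroups -/

/-- A proper subgroup containing a nontrivial Sylow `p`-subgroup `T`, and every element that
conjugates some nontrivial element of `T` into `T`, is strongly `p`-embedded. -/
theorem isStronglyEmbedded_of_sylow {p : ℕ} (hp : p.Prime) {G : Type u} [Group G] [Finite G]
    (T : Sylow p G) (hT : (T : Subgroup G) ≠ ⊥) {H : Subgroup G} (hH : H ≠ ⊤)
    (hTH : (T : Subgroup G) ≤ H)
    (h : ∀ w z : G, z ∈ T → z ≠ 1 → w * z * w⁻¹ ∈ T → w ∈ H) : IsStronglyEmbedded p H := by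
  have := Fact.mk hp
  refine ⟨hH, ?_, fun x hx => ?_⟩
  · obtain ⟨n, hn⟩ := IsPGroup.iff_card.mp T.isPGroup'
    have h0 : n ≠ 0 := by
      rintro rfl
      exact hT (Subgroup.card_eq_one.mp (by rw [hn, pow_zero]))
    exact (dvd_pow_self p h0).trans (hn ▸ Subgroup.card_dvd_of_le hTH)
  · rw [Nat.coprime_comm, hp.coprime_iff_not_dvd]
    intro hdvd
    -- By Cauchy there is y = x y' x⁻¹ of order p with both y and y' in H.
    obtain ⟨⟨y, hy⟩, hord⟩ := exists_prime_orderOf_dvd_card' p hdvd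
    rw [Subgroup.orderOf_mk] at hord
    obtain ⟨hy, y', hy'H, rfl⟩ := Subgroup.mem_inf.mp hy
    have hyx : (MulAut.conj x).toMonoidHom y' = x * y' * x⁻¹ := rfl
    rw [hyx] at hy hord
    have hord' : orderOf y' = p := by
      rw [← hord]
      exact ((MulAut.conj x).orderOf_eq y').symm
    -- T is also a Sylow subgroup of H, so Sylow's theorem inside H supplies a conjugating element
    -- from H itself.
    have conj_into : ∀ a ∈ H, orderOf a = p → ∃ k ∈ H, k * a * k⁻¹ ∈ T := by
      intro a ha hao
      have hpg : IsPGroup p (Subgroup.zpowers (⟨a, ha⟩ : H)) :=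
        IsPGroup.of_card (n := 1) (by rw [Nat.card_zpowers, Subgroup.orderOf_mk, hao, pow_one])
      obtain ⟨R, hR⟩ := hpg.exists_le_sylow
      obtain ⟨k, hk⟩ := MulAction.exists_smul_eq H R (T.subtype hTH)
      refine ⟨k, k.2, ?_⟩
      have h1 : k * ⟨a, ha⟩ * k⁻¹ ∈ T.subtype hTH := by
        rw [← hk, Sylow.smul_def]
        exact Subgroup.mem_map_of_mem (MulAut.conj k).toMonoidHom (hR (Subgroup.mem_zpowers _))
      exact h1
    obtain ⟨k, hk, hkT⟩ := conj_into _ hy hord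
    obtain ⟨l, hl, hlT⟩ := conj_into _ hy'H hord'
    -- This element conjugates k y k⁻¹ to l y' l⁻¹, both in T, so `h` applies; since k and l lie in
    -- H, so does x.
    have hw : l * x⁻¹ * k⁻¹ ∈ H := by
      refine h _ _ hkT ?_ ?_
      · intro h1
        rw [conj_eq_one_iff] at h1
        rw [h1, orderOf_one] at hord
        exact hp.one_lt.ne hord
      · convert hlT using 1
        group
    have h2 := H.mul_mem (H.mul_mem (H.inv_mem hl) hw) hk
    have h3 : l⁻¹ * (l * x⁻¹ * k⁻¹) * k = x⁻¹ := by group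
    rw [h3] at h2
    exact hx (by simpa using h2)

theorem exists_mem_normalizer_notMem {p : ℕ} (hp : p.Prime) {S : Type u} [Group S] [Finite S]
    (hS : IsPGroup p S) {P : Subgroup S} (hP : P ≠ ⊤) :
    ∃ g ∈ Subgroup.normalizer (P : Set S), g ∉ P := by
  have := Fact.mk hp
  have := hS.isNilpotent
  exact SetLike.exists_of_lt (Group.normalizerCondition_of_isNilpotent P (lt_top_iff_ne_top.mpr hP))

theorem mem_extensionDomain {S : Type u} [Group S] {P Q : Subgroup S} {φ : Q ≃* P} {g : S}
    (hg : g ∈ Subgroup.normalizer (Q : Set S)) :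
    g ∈ extensionDomain φ ↔ MulAut.congr φ (Q.normalizerMonoidHom ⟨g, hg⟩) ∈ autS P := by
  constructor
  · rintro ⟨⟨_, hg'⟩, h, rfl⟩
    exact h
  · exact fun h => ⟨⟨g, hg⟩, h, rfl⟩

/-! ### Isomorphisms in a fusion system and extensions to normalizers -/

namespace FusionSystem

variable {S : Type u} [Group S] (F : FusionSystem S)

section Basic

variable {F}

theorem iso_trans {P Q R : Subgroup S} {e : P ≃* Q} {f : Q ≃* R} (he : e ∈ F.iso P Q)
    (hf : f ∈ F.iso Q R) : e.trans f ∈ F.iso P R :=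
  ⟨F.comp_mem he.1 hf.1, F.comp_mem hf.2 he.2⟩

theorem iso_symm {P Q : Subgroup S} {e : P ≃* Q} (he : e ∈ F.iso P Q) : e.symm ∈ F.iso Q P :=
  ⟨he.2, he.1⟩

theorem aut_subset_iso {P : Subgroup S} {α : MulAut P} (h : α ∈ F.aut P) : α ∈ F.iso P P :=
  ⟨h, (F.aut P).inv_mem h⟩

theorem inclusion_mem {P Q : Subgroup S} (h : P ≤ Q) : Subgroup.inclusion h ∈ F.hom P Q :=
  F.conj_mem P Q ⟨1, fun x => by simp⟩

theorem IsConj.symm {P Q : Subgroup S} : F.IsConj P Q → F.IsConj Q P :=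
  fun ⟨e, he⟩ => ⟨e.symm, iso_symm he⟩

theorem IsConj.trans {P Q R : Subgroup S} : F.IsConj P Q → F.IsConj Q R → F.IsConj P R :=
  fun ⟨e, he⟩ ⟨f, hf⟩ => ⟨e.trans f, iso_trans he hf⟩

/-- Restrict φ to A and factor it as an isomorphism of F followed by an inclusion; the intermediate
subgroup can only be the image of A. -/
theorem isConj_map {P Q : Subgroup S} {φ : P →* Q} (hφ : φ ∈ F.hom P Q) (A : Subgroup P) :
    F.IsConj (A.map P.subtype) ((A.map φ).map Q.subtype) := by
  obtain ⟨R, h, e, he, he', heq⟩ :=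
    F.factor (F.comp_mem (inclusion_mem (Subgroup.map_subtype_le A)) hφ)
  have hval : ∀ x, ((φ (Subgroup.inclusion (Subgroup.map_subtype_le A) x) : Q) : S) = e x :=
    fun x => congrArg Subtype.val (DFunLike.congr_fun heq x)
  obtain rfl : R = (A.map φ).map Q.subtype := by
    ext y
    constructor
    · intro hy
      obtain ⟨⟨_, a, ha, rfl⟩, hx⟩ := e.surjective ⟨y, hy⟩
      exact ⟨φ a, ⟨a, ha, rfl⟩, (hval ⟨_, a, ha, rfl⟩).trans (congrArg Subtype.val hx)⟩
    · rintro ⟨_, ⟨a, ha, rfl⟩, rfl⟩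
      have h1 := (e ⟨_, a, ha, rfl⟩).2
      rw [← hval] at h1
      exact h1
  exact ⟨e, he, he'⟩

end Basic

theorem normalizerMonoidHom_of_mem {Q : Subgroup S} (q : Q) :
    Q.normalizerMonoidHom ⟨q, Subgroup.le_normalizer q.2⟩ = MulAut.conj q := by
  ext x
  rfl

theorem innerAut_le_autS (Q : Subgroup S) : innerAut Q ≤ autS Q := by
  rintro _ ⟨g, rfl⟩
  exact ⟨⟨g, Subgroup.le_normalizer g.2⟩, normalizerMonoidHom_of_mem g⟩

theorem notMem_of_normalizerMonoidHom_notMem {Q : Subgroup S}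
    {g : Subgroup.normalizer (Q : Set S)} (h : Q.normalizerMonoidHom g ∉ innerAut Q) :
    (g : S) ∉ Q :=
  fun hg => h ⟨⟨g, hg⟩, (normalizerMonoidHom_of_mem _).symm⟩

/-- Since ψ extends χ, it turns conjugation by g on P into conjugation by ψ(g) on χ(P) = Q. Using
g⁻¹ as well gives both directions of normalization. -/
theorem extension_mem_normalizer {P Q : Subgroup S} (χ : P ≃* Q)
    (ψ : Subgroup.normalizer (P : Set S) →* (⊤ : Subgroup S))
    (h : ∀ x : P, (ψ (Subgroup.inclusion Subgroup.le_normalizer x) : S) = χ x)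
    (g : Subgroup.normalizer (P : Set S)) : (ψ g : S) ∈ Subgroup.normalizer (Q : Set S) := by
  have key : ∀ (g : Subgroup.normalizer (P : Set S)) (y : S), y ∈ Q →
      (ψ g : S) * y * (ψ g : S)⁻¹ ∈ Q := by
    intro g y hy
    obtain ⟨x, hx⟩ := χ.surjective ⟨y, hy⟩
    have h1 := h (P.normalizerMonoidHom g x)
    have h2 : Subgroup.inclusion Subgroup.le_normalizer (P.normalizerMonoidHom g x) =
        g * Subgroup.inclusion Subgroup.le_normalizer x * g⁻¹ := rfl
    rw [h2, map_mul, map_mul, map_inv] at h1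
    have h3 : (ψ g : S) * ψ (Subgroup.inclusion Subgroup.le_normalizer x) * (ψ g : S)⁻¹ ∈ Q := by
      have h4 := (χ (P.normalizerMonoidHom g x)).2
      rw [← h1] at h4
      exact h4
    rw [h x, hx] at h3
    exact h3
  rw [Subgroup.mem_normalizer_iff]
  refine fun y => ⟨key g y, fun hy => ?_⟩
  have h1 := key g⁻¹ _ hy
  rw [map_inv] at h1
  convert h1 using 1
  simp [mul_assoc]

section Normalizer

variable {F} [Finite S] {p : ℕ}

/-- If `Q` is fully automized and receptive, then some isomorphism from each conjugate `P` of `Q`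
to `Q` extends to the normalizer of `P`. -/
theorem exists_extension_normalizer (hp : p.Prime) (hS : IsPGroup p S) {P Q : Subgroup S}
    (hQ : F.FullyAutomized p Q) (hQ' : F.Receptive Q) (hPQ : F.IsConj P Q) :
    ∃ χ ∈ F.iso P Q, ∃ ψ ∈ F.hom (Subgroup.normalizer (P : Set S)) ⊤,
      ∀ x : P, (ψ (Subgroup.inclusion Subgroup.le_normalizer x) : S) = χ x := by
  have := Fact.mk hp
  obtain ⟨e, he⟩ := hPQ
  obtain ⟨T, hT⟩ := hQ
  -- The transported group e Aut_S(P) e⁻¹ is a p-subgroup of Aut_F(Q), so some β in Aut_F(Q)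
  -- conjugates it into the Sylow subgroup Aut_S(Q). After correcting e by β, the extension domain
  -- contains all of N_S(P).
  have hK : IsPGroup p (((autS P).map (MulAut.congr e).toMonoidHom).subgroupOf (F.aut Q)) := by
    refine IsPGroup.comap_of_injective ?_ _ (F.aut Q).subtype_injective
    refine IsPGroup.map ?_ _
    exact IsPGroup.of_surjective (hS.to_subgroup _) P.normalizerMonoidHom.rangeRestrict
      P.normalizerMonoidHom.rangeRestrict_surjective
  obtain ⟨R, hR⟩ := hK.exists_le_sylow
  obtain ⟨β, hβ⟩ := MulAction.exists_smul_eq (F.aut Q) R T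
  have hχ : e.trans β.1 ∈ F.iso P Q := iso_trans he (aut_subset_iso β.2)
  have hN : Subgroup.normalizer (P : Set S) ≤ extensionDomain (e.trans β.1) := by
    intro g hg
    rw [mem_extensionDomain hg]
    have hmem : MulAut.congr e (P.normalizerMonoidHom ⟨g, hg⟩) ∈ F.aut Q :=
      F.comp_mem (F.comp_mem he.2 (F.autS_le_aut P ⟨⟨g, hg⟩, rfl⟩)) he.1
    have h1 : (⟨_, hmem⟩ : F.aut Q) ∈ (R : Subgroup (F.aut Q)) :=
      hR ⟨_, ⟨⟨g, hg⟩, rfl⟩, rfl⟩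
    have h2 : β * ⟨_, hmem⟩ * β⁻¹ ∈ (T : Subgroup (F.aut Q)) := by
      rw [← hβ, Sylow.smul_def]
      exact Subgroup.mem_map_of_mem (MulAut.conj β).toMonoidHom h1
    rw [hT] at h2
    exact h2
  obtain ⟨ψ, hψ, hψ'⟩ := hQ' P _ hχ
  exact ⟨_, hχ, ψ.comp (Subgroup.inclusion hN), F.comp_mem (inclusion_mem hN) hψ, hψ'⟩

/-- The extension of an isomorphism P → Q embeds N_S(P) in N_S(Q). -/
theorem fullyNormalized_of_receptive (hp : p.Prime) (hS : IsPGroup p S) {Q : Subgroup S}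
    (hQ : F.FullyAutomized p Q) (hQ' : F.Receptive Q) : F.FullyNormalized Q := by
  intro P hP
  obtain ⟨χ, -, ψ, hψ, h⟩ := exists_extension_normalizer hp hS hQ hQ' hP.symm
  refine Nat.card_le_card_of_injective (fun g => ⟨_, extension_mem_normalizer χ ψ h g⟩) ?_
  intro a b hab
  exact F.injective hψ (Subtype.ext (Subtype.mk.inj hab))

/-- The extension ψ to N_S(P) sends C_S(P) into C_S(Q) ≤ Q = ψ(P), and ψ is injective; thus the
centralizer condition need only be checked at Q. -/
theorem isCentric_of_receptive (hp : p.Prime) (hS : IsPGroup p S) {Q : Subgroup S}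
    (hQ : F.FullyAutomized p Q) (hQ' : F.Receptive Q)
    (hc : Subgroup.centralizer (Q : Set S) ≤ Q) : F.IsCentric Q := by
  intro P hP x hx
  obtain ⟨χ, -, ψ, hψ, h⟩ := exists_extension_normalizer hp hS hQ hQ' hP.symm
  have hxN : x ∈ Subgroup.normalizer (P : Set S) := Subgroup.centralizer_le_normalizer _ hx
  have h1 : (ψ ⟨x, hxN⟩ : S) ∈ Q := by
    refine hc (Subgroup.mem_centralizer_iff.mpr fun y hy => ?_)
    obtain ⟨z, hz⟩ := χ.surjective ⟨y, hy⟩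
    have hy' : y = ψ (Subgroup.inclusion Subgroup.le_normalizer z) := by rw [h z, hz]
    rw [hy', ← Subgroup.coe_mul, ← Subgroup.coe_mul, ← map_mul, ← map_mul]
    congr 2
    exact Subtype.ext (Subgroup.mem_centralizer_iff.mp hx z z.2)
  obtain ⟨z, hz⟩ := χ.surjective ⟨_, h1⟩
  have h2 : ψ (Subgroup.inclusion Subgroup.le_normalizer z) = ψ ⟨x, hxN⟩ :=
    Subtype.ext ((h z).trans (congrArg Subtype.val hz))
  have h3 : (z : S) = x := congrArg Subtype.val (F.injective hψ h2)
  exact h3 ▸ z.2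

end Normalizer

/-! ### Functions on subgroups and Alperin's fusion theorem -/

/-- The homomorphism `φ` between subgroups of `S` preserves the function `f` on subgroups of `S`:
`f (φ(A)) = f(A)` for all subgroups `A` of its domain. -/
def Preserves {X : Type*} (f : Subgroup S → X) {P Q : Subgroup S} (φ : P →* Q) : Prop :=
  ∀ A : Subgroup P, f ((A.map φ).map Q.subtype) = f (A.map P.subtype)

section Preserves

variable {X : Type*} {f : Subgroup S → X} {P Q R P' Q' : Subgroup S}

theorem Preserves.comp {φ : P →* Q} {ψ : Q →* R} (hφ : Preserves f φ) (hψ : Preserves f ψ) :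
    Preserves f (ψ.comp φ) := fun A => by
  rw [← Subgroup.map_map, hψ, hφ]

/-- Only the underlying map into S matters, so codomains may change freely. This is how preservation
passes from an extension to the map it extends. -/
theorem Preserves.restrict {φ : P →* Q} {ψ : P' →* Q'} (hψ : Preserves f ψ) (h : P ≤ P')
    (hφ : ∀ x : P, (φ x : S) = ψ (Subgroup.inclusion h x)) : Preserves f φ := fun A => by
  have h1 := hψ (A.map (Subgroup.inclusion h))
  rw [Subgroup.map_map, Subgroup.map_map, Subgroup.map_map] at h1
  rw [Subgroup.map_map]
  have h2 : Q.subtype.comp φ = Q'.subtype.comp (ψ.comp (Subgroup.inclusion h)) :=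
    MonoidHom.ext hφ
  rw [h2]
  exact h1

theorem Preserves.symm {e : P ≃* Q} (he : Preserves f e.toMonoidHom) :
    Preserves f e.symm.toMonoidHom := fun A => by
  rw [← he]
  have : e.toMonoidHom.comp e.symm.toMonoidHom = MonoidHom.id Q :=
    MonoidHom.ext e.apply_symm_apply
  rw [Subgroup.map_map A, this, Subgroup.map_id]

theorem Preserves.id : Preserves f (MonoidHom.id P) := fun A => by rw [Subgroup.map_id]

/-- The automorphisms of `P` in the fusion system that preserve `f`. -/
def preservingAut (f : Subgroup S → X) (P : Subgroup S) : Subgroup (MulAut P) where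
  carrier := {α | α ∈ F.aut P ∧ Preserves f (MulEquiv.toMonoidHom α)}
  one_mem' := ⟨one_mem _, Preserves.id⟩
  mul_mem' hα hβ := ⟨mul_mem hα.1 hβ.1, hβ.2.comp hα.2⟩
  inv_mem' hα := ⟨inv_mem hα.1, hα.2.symm⟩

/-- Conjugation by g on P is the restriction of an inner automorphism of S. -/
theorem autS_le_preservingAut (h : ∀ α ∈ F.aut ⊤, Preserves f (MulEquiv.toMonoidHom α))
    (P : Subgroup S) : autS P ≤ F.preservingAut f P := by
  rintro _ ⟨g, rfl⟩
  refine ⟨F.autS_le_aut P ⟨g, rfl⟩, ?_⟩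
  have hg : (g : S) ∈ Subgroup.normalizer ((⊤ : Subgroup S) : Set S) :=
    Subgroup.le_normalizer (Subgroup.mem_top _)
  exact (h _ (F.autS_le_aut ⊤ ⟨⟨g, hg⟩, rfl⟩)).restrict le_top fun _ => rfl

end Preserves

/-! ### Essential subgroups and the induction for Alperin's theorem -/

section Alperin

variable {F} [Finite S] {p : ℕ} {X : Type*} {f : Subgroup S → X}

/-- Receptivity extends α to its extension domain, which g makes strictly larger than Q, so the
inductive hypothesis covers the extension. -/
theorem preserves_of_mem_extensionDomain {Q : Subgroup S} (hQ : F.Receptive Q)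
    (ih : ∀ P R : Subgroup S, Nat.card Q < Nat.card P → ∀ φ ∈ F.hom P R, Preserves f φ)
    {α : MulAut Q} (hα : α ∈ F.aut Q) {g : S} (hg : g ∈ extensionDomain α) (hgQ : g ∉ Q) :
    Preserves f (MulEquiv.toMonoidHom α) := by
  obtain ⟨ψ, hψ, h⟩ := hQ Q α (aut_subset_iso hα)
  have hlt : Q < extensionDomain α :=
    lt_of_le_of_ne (le_extensionDomain α) fun h => hgQ (h ▸ hg)
  exact (ih _ _ (Set.Finite.card_lt_card (Set.toFinite _) hlt) ψ hψ).restrict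
    (le_extensionDomain α) fun x => (h x).symm

/-- The image of the Sylow subgroup `Aut_S(Q)` is a Sylow subgroup of `Out_F(Q)`. -/
theorem exists_sylow_out (hp : p.Prime) {Q : Subgroup S} (hQ : F.FullyAutomized p Q) :
    ∃ T : Sylow p (F.out Q), (T : Subgroup (F.out Q)) = (outS Q).subgroupOf (F.out Q) := by
  have := Fact.mk hp
  obtain ⟨T, hT⟩ := hQ
  let q : F.aut Q →* F.out Q := (QuotientGroup.mk' (innerAut Q)).subgroupMap (F.aut Q)
  have hq : Function.Surjective q := MonoidHom.subgroupMap_surjective _ _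
  refine ⟨T.mapSurjective hq, ?_⟩
  rw [Sylow.coe_mapSurjective, hT]
  ext ⟨x, hx⟩
  constructor
  · rintro ⟨α, hα, h⟩
    exact ⟨α, hα, congrArg Subtype.val h⟩
  · rintro ⟨α, hα, h⟩
    exact ⟨⟨α, F.autS_le_aut Q hα⟩, hα, Subtype.ext h⟩

/-- Let `Q` be proper, fully automized and receptive, and suppose that all morphisms from larger
subgroups preserve `f`. If some automorphism of `Q` does not preserve `f`, then `Q` is
essential. -/
theorem isEssential_of_not_preserves (hp : p.Prime) (hS : IsPGroup p S) {Q : Subgroup S}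
    (hQ : F.FullyAutomized p Q) (hQ' : F.Receptive Q) (hQT : Q ≠ ⊤)
    (htop : ∀ α ∈ F.aut ⊤, Preserves f (MulEquiv.toMonoidHom α))
    (ih : ∀ P R : Subgroup S, Nat.card Q < Nat.card P → ∀ φ ∈ F.hom P R, Preserves f φ)
    {α : MulAut Q} (hα : α ∈ F.aut Q) (hαf : ¬ Preserves f (MulEquiv.toMonoidHom α)) :
    F.IsEssential p Q := by
  -- An element centralizing Q induces the identity on Q, so it lies in the extension domain of
  -- every automorphism. Outside Q it would force α to preserve f.
  have hc : Subgroup.centralizer (Q : Set S) ≤ Q := by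
    intro x hx
    by_contra hxQ
    refine hαf (preserves_of_mem_extensionDomain hQ' ih hα (g := x) ?_ hxQ)
    rw [mem_extensionDomain (Subgroup.centralizer_le_normalizer _ hx)]
    have h1 : Q.normalizerMonoidHom ⟨x, Subgroup.centralizer_le_normalizer _ hx⟩ = 1 := by
      rw [← MonoidHom.mem_ker, Subgroup.normalizerMonoidHom_ker]
      exact hx
    rw [h1, map_one]
    exact one_mem _
  have hle := F.autS_le_preservingAut htop Q
  refine ⟨hQT, isCentric_of_receptive hp hS hQ hQ' hc, fullyNormalized_of_receptive hp hS hQ hQ',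
    ((F.preservingAut f Q).map (QuotientGroup.mk' (innerAut Q))).subgroupOf (F.out Q), ?_⟩
  -- The preserving automorphisms contain Inn(Q), so membership can be tested on outer classes.
  have mem_of_mk : ∀ β : MulAut Q, (β : OuterAut Q) ∈
      (F.preservingAut f Q).map (QuotientGroup.mk' (innerAut Q)) → β ∈ F.preservingAut f Q := by
    rintro β ⟨γ, hγ, h⟩
    have h1 := hle (innerAut_le_autS Q (QuotientGroup.eq.mp h))
    simpa using mul_mem hγ h1
  obtain ⟨T, hT⟩ := exists_sylow_out hp hQ
  refine isStronglyEmbedded_of_sylow hp T ?_ ?_ ?_ ?_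
  -- Out_S(Q) is nontrivial: if g in N_S(Q) outside Q acted as some q in Q, then g⁻¹q would lie in
  -- C_S(Q) ≤ Q.
  · obtain ⟨g, hg, hgQ⟩ := exists_mem_normalizer_notMem hp hS hQT
    rw [hT]
    intro hbot
    have hgS : Q.normalizerMonoidHom ⟨g, hg⟩ ∈ autS Q := ⟨_, rfl⟩
    have h1 : (⟨_, ⟨_, F.autS_le_aut Q hgS, rfl⟩⟩ : F.out Q) ∈
        (outS Q).subgroupOf (F.out Q) := ⟨_, hgS, rfl⟩
    rw [hbot, Subgroup.mem_bot] at h1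
    obtain ⟨q, hq⟩ := (QuotientGroup.eq_one_iff _).mp (congrArg Subtype.val h1)
    have h2 : (⟨g, hg⟩ : Subgroup.normalizer (Q : Set S))⁻¹ * ⟨q, Subgroup.le_normalizer q.2⟩ ∈
        Q.normalizerMonoidHom.ker := by
      rw [MonoidHom.mem_ker, map_mul, map_inv, ← hq, normalizerMonoidHom_of_mem]
      exact inv_mul_cancel _
    rw [Subgroup.normalizerMonoidHom_ker] at h2
    have h3 : g⁻¹ * q ∈ Q := hc h2
    exact hgQ (by simpa using (Subgroup.mul_mem_cancel_right Q q.2).mp h3)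
  · intro h
    have h1 : (⟨(α : OuterAut Q), α, hα, rfl⟩ : F.out Q) ∈
        ((F.preservingAut f Q).map (QuotientGroup.mk' (innerAut Q))).subgroupOf (F.out Q) :=
      h ▸ Subgroup.mem_top _
    exact hαf (mem_of_mk α h1).2
  · rw [hT]
    exact Subgroup.comap_mono (Subgroup.map_mono hle)
  -- Let w and z be the classes of β and c_g. Then β c_g β⁻¹ agrees with an element of Aut_S(Q) up
  -- to Inn(Q) ≤ Aut_S(Q), so g lies in the extension domain of β; z ≠ 1 keeps g outside Q.
  · intro w z hz hz1 hwz
    rw [← SetLike.mem_coe, ← Sylow.coe_coe, SetLike.mem_coe, hT] at hz hwz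
    obtain ⟨_, β, hβ, rfl⟩ := w
    obtain ⟨_, hzF⟩ := z
    obtain ⟨_, ⟨g, rfl⟩, rfl⟩ := hz
    obtain ⟨γ, hγ, hγw⟩ := hwz
    refine ⟨β, ⟨hβ, ?_⟩, rfl⟩
    refine preserves_of_mem_extensionDomain hQ' ih hβ (g := g) ?_ ?_
    · rw [mem_extensionDomain g.2]
      have h1 : γ⁻¹ * (β * Q.normalizerMonoidHom g * β⁻¹) ∈ innerAut Q :=
        QuotientGroup.eq.mp hγw
      have h2 := mul_mem hγ (innerAut_le_autS Q h1)
      rw [mul_inv_cancel_left] at h2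
      exact h2
    · refine notMem_of_normalizerMonoidHom_notMem fun h => hz1 ?_
      exact Subtype.ext ((QuotientGroup.eq_one_iff _).mpr h)

/-- Alperin's fusion theorem: in a saturated fusion system, a function on subgroups that is
preserved by the automorphisms of `S` and of the essential subgroups is preserved by all
morphisms. -/
theorem preserves_of_isSaturated (hp : p.Prime) (hS : IsPGroup p S) (hF : F.IsSaturated p)
    (h : ∀ R : Subgroup S, R = ⊤ ∨ F.IsEssential p R →
      ∀ α ∈ F.aut R, Preserves f (MulEquiv.toMonoidHom α))
    (P R : Subgroup S) (φ : P →* R) (hφ : φ ∈ F.hom P R) : Preserves f φ := by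
  induction hn : Nat.card S - Nat.card P using Nat.strong_induction_on generalizing P R with
  | _ n ih =>
  subst hn
  have ih' : ∀ P' R' : Subgroup S, Nat.card P < Nat.card P' → ∀ φ ∈ F.hom P' R',
      Preserves f φ := fun P' R' hlt φ hφ => by
    have h1 := P'.card_le_card_group
    exact ih _ (by omega) P' R' φ hφ rfl
  clear ih
  obtain ⟨Q, hPQ, hQ, hQ'⟩ := hF P
  -- For Q < S the normalizer of P' properly contains P', so the extension of χ is covered by
  -- induction.
  have toQ : ∀ P' : Subgroup S, F.IsConj P' Q → Q ≠ ⊤ → ∃ χ ∈ F.iso P' Q,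
      Preserves f χ.toMonoidHom := by
    intro P' hP' hQT
    obtain ⟨χ, hχ, ψ, hψ, hψχ⟩ := exists_extension_normalizer hp hS hQ hQ' hP'
    have hcard : Nat.card P' = Nat.card P :=
      (Nat.card_congr χ.toEquiv).trans (Nat.card_congr hPQ.some.toEquiv).symm
    have hP'T : P' ≠ ⊤ := by
      rintro rfl
      refine hQT (Subgroup.eq_top_of_card_eq Q ?_)
      rw [← Nat.card_congr χ.toEquiv, Subgroup.card_top]
    obtain ⟨g, hg, hgP⟩ := exists_mem_normalizer_notMem hp hS hP'T
    have hlt : P' < Subgroup.normalizer (P' : Set S) :=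
      lt_of_le_of_ne Subgroup.le_normalizer fun h => hgP (h ▸ hg)
    refine ⟨χ, hχ, (ih' _ _ ?_ ψ hψ).restrict Subgroup.le_normalizer fun x => (hψχ x).symm⟩
    rw [← hcard]
    exact Set.Finite.card_lt_card (Set.toFinite _) hlt
  have hcardQ : Nat.card Q = Nat.card P := (Nat.card_congr hPQ.some.toEquiv).symm
  have hautQ : ∀ α ∈ F.aut Q, Preserves f (MulEquiv.toMonoidHom α) := by
    intro α hα
    by_cases hQT : Q = ⊤
    · exact h Q (Or.inl hQT) α hα
    · by_contra hαf
      exact hαf (h Q (Or.inr (isEssential_of_not_preserves hp hS hQ hQ' hQT (h ⊤ (Or.inl rfl))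
        (hcardQ ▸ ih') hα hαf)) α hα)
  obtain ⟨P', hP', e, he, he', rfl⟩ := F.factor hφ
  suffices hef : Preserves f e.toMonoidHom from
    hef.restrict le_rfl fun _ => rfl
  -- When Q = S there is no larger subgroup to extend to, but then e is already an automorphism of
  -- S. Otherwise e = χ'⁻¹ ∘ α ∘ χ with α in Aut_F(Q).
  by_cases hQT : Q = ⊤
  · subst hQT
    obtain rfl : P = ⊤ := Subgroup.eq_top_of_card_eq P (by rw [← hcardQ, Subgroup.card_top])
    obtain rfl : P' = ⊤ := Subgroup.eq_top_of_card_eq P' (by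
      rw [← Nat.card_congr e.toEquiv, Subgroup.card_top])
    exact hautQ e he
  · obtain ⟨χ, hχ, hχf⟩ := toQ P hPQ hQT
    obtain ⟨χ', hχ', hχf'⟩ := toQ P' (IsConj.trans ⟨e.symm, he', he⟩ hPQ) hQT
    have hα := iso_trans (iso_trans (iso_symm hχ) ⟨he, he'⟩) hχ'
    have hαf := hautQ _ hα.1
    refine ((hχf.comp hαf).comp hχf'.symm).restrict le_rfl fun x => ?_
    change (e x : S) = χ'.symm (χ' (e (χ.symm (χ x))))
    rw [χ.symm_apply_apply, χ'.symm_apply_apply]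

end Alperin

/-! ### Units of the Burnside ring of a fusion system -/

variable {F}

/-- The inverse needs no separate condition: each mark of u is a unit of ℤ, hence its own inverse.
-/
theorem mem_burnsideUnits_iff {u : (BurnsideRing S)ˣ} :
    u ∈ F.burnsideUnits ↔ (u : BurnsideRing S) ∈ F.burnsideRing := by
  constructor
  · rintro ⟨v, rfl⟩
    exact (v : F.burnsideRing).2
  · intro hu
    have hu' : ((u⁻¹ : (BurnsideRing S)ˣ) : BurnsideRing S) ∈ F.burnsideRing := fun P Q h => by
      have hinv : ∀ R : Subgroup S, BurnsideRing.mark R ((u⁻¹ : (BurnsideRing S)ˣ) : BurnsideRing S)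
          = BurnsideRing.mark R (u : BurnsideRing S) := fun R => by
        have h1 := (Int.units_inv_eq_self (Units.map (BurnsideRing.mark R : BurnsideRing S →* ℤ) u))
        exact congrArg Units.val h1
      rw [hinv, hinv, hu P Q h]
    exact ⟨⟨⟨u, hu⟩, ⟨_, hu'⟩, Subtype.ext u.mul_inv, Subtype.ext u.inv_mul⟩, Units.ext rfl⟩

variable [Finite S]

theorem mem_ker_d_iff {P : Subgroup S} {u : (BurnsideRing S)ˣ} :
    u ∈ (F.d P).ker ↔ ∀ α ∈ F.aut P,
      Preserves (fun A => BurnsideRing.mark A (u : BurnsideRing S)) (MulEquiv.toMonoidHom α) := by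
  have h1 : u ∈ (F.d P).ker ↔ ∀ α ∈ F.aut P,
      autAction P α (BurnsideRing.res P u) = BurnsideRing.res P u := by
    rw [MonoidHom.mem_ker]
    refine (QuotientGroup.eq_one_iff (resUnits P u)).trans ?_
    constructor
    · exact fun h α hα => h (α : OuterAut P) ⟨α, hα, rfl⟩
    · rintro h _ ⟨α, hα, rfl⟩
      exact h α hα
  -- The action of an automorphism is pullback along its inverse, so α⁻¹ is the one that moves the
  -- mark at A to the mark at α(A).
  have h2 : ∀ (α : MulAut P) (A : Subgroup P),
      BurnsideRing.mark A (autAction P α⁻¹ (BurnsideRing.res P u)) =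
        BurnsideRing.mark ((A.map α.toMonoidHom).map P.subtype) (u : BurnsideRing S) := by
    intro α A
    rw [autAction_apply, inv_inv, BurnsideRing.res, BurnsideRing.mark_pullback,
      BurnsideRing.mark_pullback]
  rw [h1]
  constructor
  · intro h α hα A
    refine (h2 α A).symm.trans ?_
    rw [h _ (inv_mem hα), BurnsideRing.res, BurnsideRing.mark_pullback]
  · intro h α hα
    refine BurnsideRing.ext_mark fun A => ?_
    have h3 := h2 α⁻¹ A
    rw [inv_inv] at h3
    rw [h3]
    refine (h _ (inv_mem hα) A).trans ?_
    rw [BurnsideRing.res, BurnsideRing.mark_pullback]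

theorem burnsideUnits_le_ker_d (P : Subgroup S) : F.burnsideUnits ≤ (F.d P).ker := by
  intro u hu
  rw [mem_burnsideUnits_iff] at hu
  rw [mem_ker_d_iff]
  intro α hα A
  exact (hu _ _ (isConj_map hα A)).symm

end FusionSystem

theorem theorem6p1 {p : ℕ} (hp : p.Prime) {S : Type u} [Group S] [Finite S] (hS : IsPGroup p S)
    (F : FusionSystem S) (hF : F.IsSaturated p) :
    F.burnsideUnits = (⨅ P : Subgroup S, (F.d P).ker) ∧
    F.burnsideUnits = ⨅ R ∈ {R : Subgroup S | R = ⊤ ∨ F.IsEssential p R}, (F.d R).ker := by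
  have h1 : F.burnsideUnits ≤ ⨅ P : Subgroup S, (F.d P).ker :=
    le_iInf FusionSystem.burnsideUnits_le_ker_d
  have h2 : (⨅ P : Subgroup S, (F.d P).ker) ≤
      ⨅ R ∈ {R : Subgroup S | R = ⊤ ∨ F.IsEssential p R}, (F.d R).ker :=
    le_iInf₂ fun R _ => iInf_le _ R
  have h3 : (⨅ R ∈ {R : Subgroup S | R = ⊤ ∨ F.IsEssential p R}, (F.d R).ker) ≤
      F.burnsideUnits := by
    intro u hu
    simp only [Subgroup.mem_iInf, FusionSystem.mem_ker_d_iff] at hu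
    rw [FusionSystem.mem_burnsideUnits_iff]
    rintro P Q ⟨e, he⟩
    -- Evaluating at the whole subgroup P compares the marks at P and at e(P) = Q.
    have h := FusionSystem.preserves_of_isSaturated hp hS hF hu P Q e.toMonoidHom he.1 ⊤
    rw [Subgroup.map_top_of_surjective _ e.surjective, ← MonoidHom.range_eq_map,
      ← MonoidHom.range_eq_map, Subgroup.range_subtype, Subgroup.range_subtype] at h
    exact h.symm
  exact ⟨le_antisymm h1 (h2.trans h3), le_antisymm (h1.trans h2) h3⟩
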